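/- **Corollary 3.3.** Let $k\ge 1$ be an integer and let $\beta=(\beta_{i,j})_{i,j\in\mathbb Z_{\ge 0},\,i+j\le 2k}$ be a real bisequence. Let $M(k)=(\beta_{i+i',j+j'})$ be its moment matrix, with rows and columns indexed by the monomials $X^iY^j$, $i+j\le k$. For a polynomial $p=\sum_{i+j\le k}a_{ij}x^iy^j$ let $p(X,Y)=\sum a_{ij}X^iY^j$ denote the corresponding linear combination of columns of $M(k)$. Suppose that $M(k)$ is positive semidefinite and recursively generated, i.e. whenever $p,q,pq$ are polynomials of degree at most $k$ and $p(X,Y)=0$, then $(pq)(X,Y)=0$. Put $u^{(i)}=(\beta_{0,i},\beta_{1,i},\beta_{2,i})$ for $i=0,\dots,2k-2$ and let $$\widehat\beta=(u^{(0)},\dots,u^{(2k-2)}),\qquad \widetilde\beta=(u^{(0)},\dots,u^{(2k-2)},\beta_{0,2k-1},\beta_{1,2k-1}),$$ regarded as real sequences of lengths $6k-3$ and $6k-1$. For $\gamma=(\gamma_0,\dots,\gamma_{2n})$ write $A_\gamma=(\gamma_{i+j})_{i,j=0}^n$ for its Hankel matrix, so that $A_{\widehat\beta}$ has size $3k-1$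 and $A_{\widetilde\beta}$ has size $3k$. A *representing measure* for $\beta$ supported on $y=x^3$ is a positive Borel measure $\mu$ on $\mathbb R^2$ with support contained in $\{(x,y):y=x^3\}$ such that, for all $i+j\le 2k$, $x^iy^j$ is $\mu$-integrable and $\beta_{i,j}=\int x^iy^j\,d\mu$. A measure is *$n$-atomic* if it is a linear combination, with positive coefficients, of the point masses at $n$ distinct points. Then $\beta$ has a representing measure supported on $y=x^3$ if and only if both of the following hold: 1. if $k\ge 3$, then $Y=X^3$ is a column relation of $M(k)$; if $k=2$, then $\beta_{0,1}=\beta_{3,0}$, $\beta_{1,1}=\beta_{4,0}$ and $\beta_{0,2}=\beta_{3,1}$ (for $k=1$ there is no condition); 2. either $A_{\widetilde\beta}\succ0$, or $A_{\widetilde\beta}\succeq0$ and $\operatorname{rank}A_{\widehat\beta}=\operatorname{rank}A_{\widetilde\beta}=\operatorname{rank}M(k)$. Moreover, if such a representing measure exists, then: - if $A_{\widetilde\beta}$ is nonsingular, there exists a $(3k)$-atomic representing measure for $\beta$ supported on $y=x^3$; - if $A_{\widetilde\beta}$ is singular, every representing measure for $\beta$ supported on $y=x^3$ is $(\operatorname{rank}M(k))$-atomic.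 -/

import Mathlib

namespace CubicMoment

open MeasureTheory

/-- The exponents `(i, j)` of the monomials `X^i Y^j` of degree at most `k`. -/
def exponents (k : ℕ) : Finset (ℕ × ℕ) :=
  (Finset.range (k + 1) ×ˢ Finset.range (k + 1)).filter fun a => a.1 + a.2 ≤ k

/-- The moment matrix `M(k)`: rows and columns are indexed by the monomials of degree at most `k`,
and the entry in row `X^i Y^j` and column `X^i' Y^j'` is `β_{i+i', j+j'}`. Only the moments
`β_{i,j}` with `i + j ≤ 2k` occur. -/
def momentMatrix (k : ℕ) (β : ℕ → ℕ → ℝ) : Matrix (exponents k) (exponents k) ℝ :=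
  Matrix.of fun a b => β (a.1.1 + b.1.1) (a.1.2 + b.1.2)

/-- The coefficient vector of a bivariate polynomial (variables `X 0 = x`, `X 1 = y`) with respect
to the monomials of degree at most `k`. -/
noncomputable def coeffVec (k : ℕ) (p : MvPolynomial (Fin 2) ℝ) : exponents k → ℝ :=
  fun a => p.coeff (Finsupp.single 0 a.1.1 + Finsupp.single 1 a.1.2)

/-- For a polynomial `p = ∑ a_{ij} x^i y^j` of degree at most `k`, the vector
`p(X) = ∑ a_{ij} X^i Y^j` in the column space of `M(k)`, where `X^i Y^j` is the column of `M(k)`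
with that label. -/
noncomputable def evalColumns (k : ℕ) (β : ℕ → ℕ → ℝ) (p : MvPolynomial (Fin 2) ℝ) :
    exponents k → ℝ :=
  ∑ a : exponents k, coeffVec k p a • (momentMatrix k β).col a

/-- `M(k)` is recursively generated: if `p`, `q`, `pq` have degree at most `k` and `p(X) = 0`,
then `(pq)(X) = 0`. -/
def RecursivelyGenerated (k : ℕ) (β : ℕ → ℕ → ℝ) : Prop :=
  ∀ p q : MvPolynomial (Fin 2) ℝ,
    p.totalDegree ≤ k → q.totalDegree ≤ k → (p * q).totalDegree ≤ k →
      evalColumns k β p = 0 → evalColumns k β (p * q) = 0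

/-- The Hankel matrix `(γ_{i+j})_{i,j=0}^n` of the finite sequence `(γ_0, …, γ_{2n})`. -/
def hankel (n : ℕ) (γ : ℕ → ℝ) : Matrix (Fin (n + 1)) (Fin (n + 1)) ℝ :=
  Matrix.of fun i j => γ (i + j)

/-- The concatenation of the blocks `u^(i) = (β_{0,i}, β_{1,i}, β_{2,i})`, `i = 0, 1, 2, …`. -/
def blockSeq (β : ℕ → ℕ → ℝ) (m : ℕ) : ℝ := β (m % 3) (m / 3)

/-- The Hankel matrix of `β̂ = (u^(0), …, u^(2k-2))`. For `k ≥ 1` this sequence consists of the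
first `3(2k-1) = 2(3k-2) + 1` terms of `blockSeq β`, so the matrix has size `3k-1`. -/
def hankelHat (k : ℕ) (β : ℕ → ℕ → ℝ) : Matrix (Fin (3 * k - 2 + 1)) (Fin (3 * k - 2 + 1)) ℝ :=
  hankel (3 * k - 2) (blockSeq β)

/-- The Hankel matrix of `β̃ = (u^(0), …, u^(2k-2), β_{0,2k-1}, β_{1,2k-1})`. For `k ≥ 1` this
sequence consists of the first `6k-1 = 2(3k-1) + 1` terms of `blockSeq β`, so the matrix has
size `3k`. -/
def hankelTilde (k : ℕ) (β : ℕ → ℕ → ℝ) : Matrix (Fin (3 * k - 1 + 1)) (Fin (3 * k - 1 + 1)) ℝ :=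
  hankel (3 * k - 1) (blockSeq β)

/-- The curve `y = x³`. -/
def cubic : Set (ℝ × ℝ) := {z | z.2 = z.1 ^ 3}

/-- `μ` is a positive Borel measure on the plane with support in `K` whose moments up to
degree `2k` exist and are the numbers `β_{i,j}`. -/
def IsRepresenting (k : ℕ) (β : ℕ → ℕ → ℝ) (K : Set (ℝ × ℝ)) (μ : Measure (ℝ × ℝ)) : Prop :=
  μ.support ⊆ K ∧
    ∀ i j : ℕ, i + j ≤ 2 * k →
      Integrable (fun z : ℝ × ℝ => z.1 ^ i * z.2 ^ j) μ ∧
        β i j = ∫ z, z.1 ^ i * z.2 ^ j ∂μ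

/-- `μ` is `n`-atomic: a combination, with positive densities, of the point masses at `n`
distinct points. -/
def IsAtomic (n : ℕ) (μ : Measure (ℝ × ℝ)) : Prop :=
  ∃ (s : Finset (ℝ × ℝ)) (w : ℝ × ℝ → ℝ), s.card = n ∧ (∀ z ∈ s, 0 < w z) ∧
    μ = ∑ z ∈ s, ENNReal.ofReal (w z) • Measure.dirac z

end CubicMoment

/-! On `y = x³` the monomial `x^i y^j` equals `x^(i+3j)`, so condition 1 makes `β` a one-variable
sequence `γ`. For `i + j ≤ 2k` the exponent `i + 3j` takes every value in `0, …, 6k` except `6k -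
1`. The problem is thus a truncated Hamburger problem with one missing moment. With `3k = n + 2`,
the missing order is `2n + 3`, and the two Hankel matrices are `hankel n` (hat) and `hankel (n + 1)`
(tilde).

Sufficiency: write the tilde matrix as a Gram matrix of vectors `v_i`. The Hankel structure makes
the shift `v_i ↦ v_{i+1}` a symmetric operator, whose spectral decomposition gives the atoms. In the
definite case one must add a vector `v_{n+2}`; its inner product with `v_{n+1}` is the missing
moment and is free, and `M(k) ⪰ 0` makes its prescribed norm large enough. In the singular case the
shift already acts on the span of `v_0, …, v_n`, and the rank of `M(k)` forces the moment of order
`2n + 4` to agree.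

Necessity: Hankel forms are integrals of squares. If the tilde matrix is singular, a nonzero
polynomial in `x` of degree at most `3k - 1` vanishes almost everywhere, so the measure has at most
`3k - 1` atoms, and all three ranks count them. -/

namespace CubicMoment

open MeasureTheory

/-! ### Gram matrices and their rank -/

section Gram

variable {ι : Type*} [Fintype ι]

/-- A positive semidefinite real matrix is the Gram matrix of a family of vectors. -/
theorem exists_inner_eq_of_posSemidef {G : Matrix ι ι ℝ} (hG : G.PosSemidef) :
    ∃ v : ι → EuclideanSpace ℝ ι, ∀ a b, inner ℝ (v a) (v b) = G a b := by
  classical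
  open scoped MatrixOrder Matrix.Norms.L2Operator in
  obtain ⟨B, rfl⟩ := CStarAlgebra.nonneg_iff_eq_star_mul_self.mp hG.nonneg
  refine ⟨fun a => WithLp.toLp 2 fun i => B i a, fun a b => ?_⟩
  simp [PiLp.inner_apply, Matrix.star_eq_conjTranspose, Matrix.mul_apply, mul_comm]

variable {E : Type*} [NormedAddCommGroup E] [InnerProductSpace ℝ E] [FiniteDimensional ℝ E]

/-- The rank of a Gram matrix is the dimension of the span of the vectors. -/
theorem rank_eq_finrank_span_of_inner_eq {G : Matrix ι ι ℝ} {v : ι → E}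
    (h : ∀ a b, inner ℝ (v a) (v b) = G a b) :
    G.rank = Module.finrank ℝ (Submodule.span ℝ (Set.range v)) := by
  classical
  let b := stdOrthonormalBasis ℝ E
  have hG : G = Matrix.gram ℝ v := by
    ext i j; rw [Matrix.gram_apply, h]
  rw [hG, Matrix.gram_eq_conjTranspose_mul b v, Matrix.rank_conjTranspose_mul_self,
    Matrix.rank_eq_finrank_span_cols]
  have : Set.range (Matrix.col (Matrix.of fun i j => b.repr (v j) i)) =
      (b.repr.toLinearEquiv.trans (WithLp.linearEquiv 2 ℝ _)).toLinearMap '' Set.range v := by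
    rw [← Set.range_comp]
    rfl
  erw [this]
  rw [← Submodule.map_span, LinearEquiv.finrank_map_eq]

end Gram

/-! ### Symmetric shift operators and their spectral measures -/

section Shift

variable {E : Type*} [NormedAddCommGroup E] [InnerProductSpace ℝ E] [FiniteDimensional ℝ E]

/-- If `⟪v (i + 1), v j⟫ = ⟪v i, v (j + 1)⟫` and `v 0, …, v (n - 1)` span the space, then
`v i ↦ v (i + 1)` extends to a symmetric operator. -/
theorem exists_isSymmetric_shift {n : ℕ} {v : ℕ → E}
    (hv : ∀ i < n, ∀ j < n, inner ℝ (v (i + 1)) (v j) = inner ℝ (v i) (v (j + 1)))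
    (hspan : Submodule.span ℝ (v '' Set.Iio n) = ⊤) :
    ∃ T : E →ₗ[ℝ] E, T.IsSymmetric ∧ ∀ i < n, T (v i) = v (i + 1) := by
  let Φ : (Fin n → ℝ) →ₗ[ℝ] E := Fintype.linearCombination ℝ fun i : Fin n => v i
  let Ψ : (Fin n → ℝ) →ₗ[ℝ] E := Fintype.linearCombination ℝ fun i : Fin n => v (i + 1)
  have hΦ (a) : Φ a = ∑ i, a i • v i := rfl
  have hΨ (a) : Ψ a = ∑ i, a i • v (i + 1) := rfl
  have hsurj : LinearMap.range Φ = ⊤ := by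
    rw [Fintype.range_linearCombination, ← hspan]
    congr 1
    ext x
    simp only [Set.mem_range, Set.mem_image, Set.mem_Iio]
    exact ⟨fun ⟨i, hi⟩ => ⟨i, i.2, hi⟩, fun ⟨i, hi, h⟩ => ⟨⟨i, hi⟩, h⟩⟩
  have hsymm (a b) : inner ℝ (Ψ a) (Φ b) = inner ℝ (Φ a) (Ψ b) := by
    simp only [hΦ, hΨ, sum_inner, inner_sum, real_inner_smul_left, real_inner_smul_right]
    refine Finset.sum_congr rfl fun i _ => Finset.sum_congr rfl fun j _ => ?_
    rw [hv j j.2 i i.2]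
  -- Well-definedness of the shift: `Ψ a` is some `Φ b`, so its squared norm is `⟪Φ a, Ψ b⟫ = 0`.
  have hker (a) (ha : Φ a = 0) : Ψ a = 0 := by
    obtain ⟨b, hb⟩ := LinearMap.range_eq_top.mp hsurj (Ψ a)
    rw [← inner_self_eq_zero (𝕜 := ℝ)]
    nth_rw 2 [← hb]
    rw [hsymm, ha, inner_zero_left]
  obtain ⟨σ, hσ⟩ := Φ.exists_rightInverse_of_surjective hsurj
  have hσ' (x) : Φ (σ x) = x := LinearMap.congr_fun hσ x
  have hT (a) : Ψ (σ (Φ a)) = Ψ a := by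
    rw [← sub_eq_zero, ← map_sub]
    exact hker _ (by rw [map_sub, hσ', sub_self])
  refine ⟨Ψ ∘ₗ σ, fun x y => ?_, fun i hi => ?_⟩
  · have := hsymm (σ x) (σ y)
    rwa [hσ', hσ'] at this
  · have h1 := hT (Pi.single ⟨i, hi⟩ 1)
    have h2 : Φ (Pi.single ⟨i, hi⟩ 1) = v i := by
      simp [Φ]
    have h3 : Ψ (Pi.single ⟨i, hi⟩ 1) = v (i + 1) := by
      simp [Ψ]
    rwa [h2, h3] at h1

/-- The moments `⟪T ^ a x, T ^ b x⟫` of a symmetric operator are those of a measure supported on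
the eigenvalues. -/
theorem exists_inner_pow_eq_sum {T : E →ₗ[ℝ] E} (hT : T.IsSymmetric) {d : ℕ}
    (hd : Module.finrank ℝ E = d) (x : E) :
    ∃ c l : Fin d → ℝ, ∀ a b : ℕ,
      inner ℝ ((T ^ a) x) ((T ^ b) x) = ∑ i, c i ^ 2 * l i ^ (a + b) := by
  let e := hT.eigenvectorBasis hd
  have key (i) (a : ℕ) : inner ℝ (e i) ((T ^ a) x) = hT.eigenvalues hd i ^ a * inner ℝ (e i) x := by
    induction a with
    | zero => simp
    | succ a ih =>
      rw [pow_succ', Module.End.mul_apply, ← hT, hT.apply_eigenvectorBasis, real_inner_smul_left,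
        ih]
      simp only [RCLike.ofReal_real_eq_id, id_eq]
      ring
  refine ⟨fun i => inner ℝ (e i) x, hT.eigenvalues hd, fun a b => ?_⟩
  rw [← e.sum_inner_mul_inner]
  refine Finset.sum_congr rfl fun i _ => ?_
  rw [real_inner_comm, key, key]
  ring

end Shift

/-! ### Hamburger problem with one missing moment -/

section Hankel

theorem image_Iic_eq_range {α : Type*} (v : ℕ → α) (n : ℕ) :
    v '' Set.Iic n = Set.range fun i : Fin (n + 1) => v i := by
  ext x
  simp only [Set.mem_range, Set.mem_image, Set.mem_Iic]
  exact ⟨fun ⟨i, hi, h⟩ => ⟨⟨i, Nat.lt_succ_of_le hi⟩, h⟩,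
    fun ⟨i, hi⟩ => ⟨i, Nat.lt_succ_iff.mp i.2, hi⟩⟩

variable {E : Type*} [NormedAddCommGroup E] [InnerProductSpace ℝ E]

theorem inner_sum_smul {ι : Type*} [Fintype ι] (c : ι → ℝ) (v : ι → E) (x : E) :
    inner ℝ (∑ i, c i • v i) x = ∑ i, c i * inner ℝ (v i) x := by
  simp only [sum_inner, real_inner_smul_left]

theorem inner_sum_smul_self {n : ℕ} {γ : ℕ → ℝ} {v : ℕ → E}
    (hv : ∀ i ≤ n, ∀ j ≤ n, inner ℝ (v i) (v j) = γ (i + j)) (c : Fin (n + 1) → ℝ) {j : ℕ}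
    (hj : j ≤ n) :
    inner ℝ (∑ i, c i • v i) (v j) = ∑ i : Fin (n + 1), c i * γ (i + j) := by
  rw [inner_sum_smul]
  exact Finset.sum_congr rfl fun i _ => by rw [hv i (Nat.lt_succ_iff.mp i.2) j hj]

/-- A positive semidefinite Hankel matrix is the Gram matrix of a family of vectors. -/
theorem exists_inner_eq_of_hankel_posSemidef {n : ℕ} {γ : ℕ → ℝ} (h : (hankel n γ).PosSemidef) :
    ∃ v : ℕ → EuclideanSpace ℝ (Fin (n + 1)),
      ∀ i ≤ n, ∀ j ≤ n, inner ℝ (v i) (v j) = γ (i + j) := by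
  obtain ⟨w, hw⟩ := exists_inner_eq_of_posSemidef h
  refine ⟨fun i => w (Fin.ofNat (n + 1) i), fun i hi j hj => ?_⟩
  rw [hw]
  simp [hankel, Fin.ofNat, Nat.mod_eq_of_lt (Nat.lt_succ_of_le hi),
    Nat.mod_eq_of_lt (Nat.lt_succ_of_le hj)]

theorem finrank_span_image_Iic [FiniteDimensional ℝ E] {n : ℕ} {γ : ℕ → ℝ} {v : ℕ → E}
    (hv : ∀ i ≤ n, ∀ j ≤ n, inner ℝ (v i) (v j) = γ (i + j)) :
    Module.finrank ℝ (Submodule.span ℝ (v '' Set.Iic n)) = (hankel n γ).rank := by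
  rw [rank_eq_finrank_span_of_inner_eq (G := hankel n γ) (v := fun i : Fin (n + 1) => v i)
    (fun a b => hv a (Nat.lt_succ_iff.mp a.2) b (Nat.lt_succ_iff.mp b.2))]
  rw [image_Iic_eq_range]

theorem hankel_posDef_of_succ {n : ℕ} {γ : ℕ → ℝ} (h : (hankel (n + 1) γ).PosDef) :
    (hankel n γ).PosDef := by
  have := h.submatrix (Fin.castSucc_injective (n + 1))
  exact this

/-- Truncated Hamburger problem with the moment of order `2 * n + 3` missing, nonsingular case. -/
theorem exists_atoms_of_hankel_posDef {n : ℕ} {γ : ℕ → ℝ} (h : (hankel (n + 1) γ).PosDef)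
    {u : ℕ → E} (hu : ∀ i ≤ n, ∀ j ≤ n, inner ℝ (u i) (u j) = γ (i + j))
    (hu' : ∀ i ≤ n, inner ℝ (u i) (u (n + 2)) = γ (n + 2 + i))
    (hu'' : inner ℝ (u (n + 2)) (u (n + 2)) = γ (2 * n + 4)) :
    ∃ c l : Fin (n + 2) → ℝ, ∀ m, m ≤ 2 * n + 2 ∨ m = 2 * n + 4 →
      γ m = ∑ i, c i ^ 2 * l i ^ m := by
  obtain ⟨v, hv⟩ := exists_inner_eq_of_hankel_posSemidef h.posSemidef
  have hvn : ∀ i ≤ n, ∀ j ≤ n, inner ℝ (v i) (v j) = γ (i + j) :=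
    fun i hi j hj => hv i (by omega) j (by omega)
  have hspan : Submodule.span ℝ (v '' Set.Iic (n + 1)) = ⊤ := by
    apply Submodule.eq_top_of_finrank_eq
    rw [finrank_span_image_Iic hv, Matrix.rank_of_isUnit _ h.isUnit]
    simp
  -- `c` holds the coordinates of the projection `p` of the vector to be built onto the span of `v
  -- 0, …, v n`.
  obtain ⟨c, hc⟩ : ∃ c : Fin (n + 1) → ℝ, ∀ j ≤ n,
      ∑ i : Fin (n + 1), c i * γ (i + j) = γ (n + 2 + j) := by
    have hdet : IsUnit (hankel n γ).det :=
      (Matrix.isUnit_iff_isUnit_det _).mp (hankel_posDef_of_succ h).isUnit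
    let g : Fin (n + 1) → ℝ := fun j => γ (n + 2 + j)
    refine ⟨(hankel n γ)⁻¹.mulVec g, fun j hj => ?_⟩
    have := congrFun (show (hankel n γ).mulVec ((hankel n γ)⁻¹.mulVec g) = g by
      rw [Matrix.mulVec_mulVec, Matrix.mul_nonsing_inv _ hdet, Matrix.one_mulVec])
      ⟨j, Nat.lt_succ_of_le hj⟩
    rw [Matrix.mulVec, dotProduct] at this
    rw [show γ (n + 2 + j) = g ⟨j, Nat.lt_succ_of_le hj⟩ from rfl, ← this]
    exact Finset.sum_congr rfl fun i _ => by simp [hankel, mul_comm, add_comm]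
  set p := ∑ i : Fin (n + 1), c i • v i with hp
  have hpv (j) (hj : j ≤ n) : inner ℝ p (v j) = γ (n + 2 + j) := by
    rw [hp, inner_sum_smul_self hvn c hj, hc j hj]
  have hpp : inner ℝ p p = ∑ i : Fin (n + 1), c i * γ (n + 2 + i) := by
    conv_lhs => rw [hp]
    rw [sum_inner]
    refine Finset.sum_congr rfl fun i _ => ?_
    rw [real_inner_smul_left, real_inner_comm, hpv i (Nat.lt_succ_iff.mp i.2)]
  -- The vectors `u` carry the positivity of `M(k)`: `q` projects `u (n + 2)` and has the same norm
  -- as `p`.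
  have hle : inner ℝ p p ≤ γ (2 * n + 4) := by
    set q := ∑ i : Fin (n + 1), c i • u i with hq
    have h1 : inner ℝ q (u (n + 2)) = inner ℝ p p := by
      rw [hpp, hq, sum_inner]
      refine Finset.sum_congr rfl fun i _ => ?_
      rw [real_inner_smul_left, hu' i (Nat.lt_succ_iff.mp i.2)]
    have h2 : inner ℝ q q = inner ℝ p p := by
      conv_lhs => rw [hq]
      rw [hpp, sum_inner]
      refine Finset.sum_congr rfl fun i _ => ?_
      rw [real_inner_smul_left, real_inner_comm,
        inner_sum_smul_self hu c (Nat.lt_succ_iff.mp i.2), hc i (Nat.lt_succ_iff.mp i.2)]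
    have h3 : 0 ≤ inner ℝ (u (n + 2) - q) (u (n + 2) - q) := real_inner_self_nonneg
    rw [real_inner_sub_sub_self, hu'', real_inner_comm, h1, h2] at h3
    linarith
  obtain ⟨e, he, hev⟩ : ∃ e : EuclideanSpace ℝ (Fin (n + 1 + 1)), inner ℝ e e = 1 ∧
      ∀ j ≤ n, inner ℝ e (v j) = 0 := by
    set W := Submodule.span ℝ (v '' Set.Iic n)
    have hW : Wᗮ ≠ ⊥ := by
      rw [Ne, Submodule.orthogonal_eq_bot_iff]
      intro hW
      have h1 := finrank_span_image_Iic hvn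
      have h2 := Matrix.rank_le_card_width (hankel n γ)
      rw [← h1] at h2
      change Module.finrank ℝ W ≤ _ at h2
      rw [hW] at h2
      simp at h2
    obtain ⟨e, heW, he0⟩ := Submodule.exists_mem_ne_zero_of_ne_bot hW
    refine ⟨(‖e‖⁻¹ : ℝ) • e, ?_, fun j hj => ?_⟩
    · rw [real_inner_smul_left, real_inner_smul_right, real_inner_self_eq_norm_sq]
      have := norm_ne_zero_iff.mpr he0
      field_simp
    · rw [real_inner_smul_left, Submodule.inner_left_of_mem_orthogonal
        (Submodule.subset_span (Set.mem_image_of_mem v (Set.mem_Iic.mpr hj))) heW, mul_zero]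
  have hep : inner ℝ e p = 0 := by
    rw [hp, inner_sum]
    refine Finset.sum_eq_zero fun i _ => ?_
    rw [real_inner_smul_right, hev i (Nat.lt_succ_iff.mp i.2), mul_zero]
  -- The component along `e` corrects the norm without disturbing the products with `v 0, …, v n`.
  let s := Real.sqrt (γ (2 * n + 4) - inner ℝ p p)
  let f : ℕ → EuclideanSpace ℝ (Fin (n + 1 + 1)) := Function.update v (n + 2) (p + s • e)
  have hf (i) (hi : i ≤ n + 1) : f i = v i := Function.update_of_ne (by omega) _ _
  have hf' : f (n + 2) = p + s • e := Function.update_self _ _ _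
  have hfv (j) (hj : j ≤ n) : inner ℝ (f (n + 2)) (v j) = γ (n + 2 + j) := by
    rw [hf', inner_add_left, real_inner_smul_left, hev j hj, hpv j hj, mul_zero, add_zero]
  have hff : inner ℝ (f (n + 2)) (f (n + 2)) = γ (2 * n + 4) := by
    rw [hf', real_inner_add_add_self, real_inner_smul_right, real_inner_smul_left,
      real_inner_smul_right, real_inner_comm e p, hep, he]
    have : s * s = γ (2 * n + 4) - inner ℝ p p := Real.mul_self_sqrt (by linarith)
    linarith
  obtain ⟨T, hT, hTf⟩ := exists_isSymmetric_shift (n := n + 2) (v := f) (by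
    have key (i) (hi : i ≤ n) (j) (hj : j ≤ n + 1) :
        inner ℝ (f (i + 1)) (f j) = inner ℝ (f i) (f (j + 1)) := by
      rw [hf (i + 1) (by omega), hf j hj, hf i (by omega), hv _ (by omega) _ hj]
      rcases Nat.lt_or_ge j (n + 1) with hj' | hj'
      · rw [hf _ (by omega), hv _ (by omega) _ (by omega)]
        congr 1; omega
      · obtain rfl : j = n + 1 := by omega
        rw [real_inner_comm, hfv i hi]
        congr 1; omega
    intro i hi j hj
    rcases Nat.lt_or_ge i (n + 1) with hi' | hi'
    · exact key i (by omega) j (by omega)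
    · obtain rfl : i = n + 1 := by omega
      rcases Nat.lt_or_ge j (n + 1) with hj' | hj'
      · rw [real_inner_comm, ← key j (by omega) (n + 1) le_rfl, real_inner_comm]
      -- Only here does the missing moment occur; symmetry of the inner product suffices, whatever
      -- its value.
      · obtain rfl : j = n + 1 := by omega
        rw [real_inner_comm])
    (by
      rw [← hspan, show Set.Iio (n + 2) = Set.Iic (n + 1) from Set.ext fun _ => Nat.lt_succ_iff]
      exact congrArg _ (Set.image_congr fun i hi => hf i hi))
  have hpow (i) (hi : i ≤ n + 2) : f i = (T ^ i) (f 0) := by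
    induction i with
    | zero => rfl
    | succ i ih => rw [pow_succ', Module.End.mul_apply, ← ih (by omega), hTf i (by omega)]
  obtain ⟨c, l, hcl⟩ := exists_inner_pow_eq_sum hT (d := n + 2) (by simp) (f 0)
  refine ⟨c, l, fun m hm => ?_⟩
  rcases hm with hm | rfl
  · obtain ⟨a, b, ha, hb, rfl⟩ : ∃ a b, a ≤ n + 1 ∧ b ≤ n + 1 ∧ m = a + b :=
      ⟨m / 2, m - m / 2, by omega, by omega, by omega⟩
    rw [← hcl, ← hpow a (by omega), ← hpow b (by omega), hf a ha, hf b hb, hv a ha b hb]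
  · rw [← hff, hpow (n + 2) le_rfl, hcl]
    exact Finset.sum_congr rfl fun i _ => by congr 2; omega

/-- Truncated Hamburger problem with the moment of order `2 * n + 3` missing, singular case. -/
theorem exists_atoms_of_hankel_rank_eq {n : ℕ} {γ : ℕ → ℝ} (h : (hankel (n + 1) γ).PosSemidef)
    (hrank : (hankel n γ).rank = (hankel (n + 1) γ).rank)
    {u : ℕ → E} (hu : ∀ i ≤ n, ∀ j ≤ n, inner ℝ (u i) (u j) = γ (i + j))
    (hu' : ∀ i ≤ n, inner ℝ (u i) (u (n + 2)) = γ (n + 2 + i))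
    (hu'' : inner ℝ (u (n + 2)) (u (n + 2)) = γ (2 * n + 4))
    (hmem : u (n + 2) ∈ Submodule.span ℝ (u '' Set.Iic n)) :
    ∃ (d : ℕ) (c l : Fin d → ℝ), ∀ m, m ≤ 2 * n + 2 ∨ m = 2 * n + 4 →
      γ m = ∑ i, c i ^ 2 * l i ^ m := by
  obtain ⟨v, hv⟩ := exists_inner_eq_of_hankel_posSemidef h
  have hvn : ∀ i ≤ n, ∀ j ≤ n, inner ℝ (v i) (v j) = γ (i + j) :=
    fun i hi j hj => hv i (by omega) j (by omega)
  set W := Submodule.span ℝ (v '' Set.Iic n) with hW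
  have hWeq : W = Submodule.span ℝ (v '' Set.Iic (n + 1)) := by
    apply Submodule.eq_of_le_of_finrank_eq
    · exact Submodule.span_mono (Set.image_mono (Set.Iic_subset_Iic.mpr (by omega)))
    · rw [finrank_span_image_Iic hv, hW, finrank_span_image_Iic hvn, hrank]
  have hvW (i) (hi : i ≤ n + 1) : v i ∈ W := by
    rw [hWeq]; exact Submodule.subset_span ⟨i, hi, rfl⟩
  -- Equality of ranks puts `v (n + 1)` in `W`, so the shift can act on `W` itself; the value `0` is
  -- a dummy.
  let w : ℕ → W := fun i => if hi : i ≤ n + 1 then ⟨v i, hvW i hi⟩ else 0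
  have hw (i) (hi : i ≤ n + 1) : (w i : EuclideanSpace ℝ (Fin (n + 1 + 1))) = v i := by
    simp [w, hi]
  have hww (i) (hi : i ≤ n + 1) (j) (hj : j ≤ n + 1) : inner ℝ (w i) (w j) = γ (i + j) := by
    rw [Submodule.coe_inner, hw i hi, hw j hj, hv i hi j hj]
  have hspan : Submodule.span ℝ (w '' Set.Iic n) = ⊤ := by
    apply Submodule.map_injective_of_injective W.injective_subtype
    have hi : W.subtype '' (w '' Set.Iic n) = v '' Set.Iic n := by
      rw [← Set.image_comp]
      exact Set.image_congr fun i hi => hw i ((Set.mem_Iic.mp hi).trans (by omega))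
    rw [Submodule.map_span, Submodule.map_top, Submodule.range_subtype, hi]
  obtain ⟨T, hT, hTw⟩ := exists_isSymmetric_shift (n := n + 1) (v := w)
    (fun i hi j hj => by
      rw [hww _ (by omega) _ (by omega), hww _ (by omega) _ (by omega)]
      congr 1; omega)
    (by rw [show Set.Iio (n + 1) = Set.Iic n from Set.ext fun _ => Nat.lt_succ_iff, hspan])
  have hpow (i) (hi : i ≤ n + 1) : w i = (T ^ i) (w 0) := by
    induction i with
    | zero => rfl
    | succ i ih => rw [pow_succ', Module.End.mul_apply, ← ih (by omega), hTw i (by omega)]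
  obtain ⟨c, l, hcl⟩ := exists_inner_pow_eq_sum hT rfl (w 0)
  refine ⟨_, c, l, fun m hm => ?_⟩
  rcases hm with hm | rfl
  · obtain ⟨a, b, ha, hb, rfl⟩ : ∃ a b, a ≤ n + 1 ∧ b ≤ n + 1 ∧ m = a + b :=
      ⟨m / 2, m - m / 2, by omega, by omega, by omega⟩
    rw [← hcl, ← hpow a ha, ← hpow b hb, hww a ha b hb]
  · obtain ⟨q, hq⟩ : ∃ q : Fin (n + 1) → ℝ, u (n + 2) = ∑ i, q i • u i := by
      rw [image_Iic_eq_range, Submodule.mem_span_range_iff_exists_fun] at hmem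
      exact ⟨hmem.choose, hmem.choose_spec.symm⟩
    have hq1 (j) (hj : j ≤ n) : ∑ i : Fin (n + 1), q i * γ (i + j) = γ (n + 2 + j) := by
      rw [← inner_sum_smul_self hu q hj, ← hq, real_inner_comm, hu' j hj]
    have hq2 : ∑ i : Fin (n + 1), q i * γ (n + 2 + i) = γ (2 * n + 4) := by
      rw [← hu'']
      conv_rhs => rw [hq, sum_inner, ← hq]
      refine Finset.sum_congr rfl fun i _ => ?_
      rw [real_inner_smul_left, hu' i (Nat.lt_succ_iff.mp i.2)]
    have hTj (j) (hj : j ≤ n) : inner ℝ ((T ^ (n + 2)) (w 0)) (w j) = γ (n + 2 + j) := by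
      rw [pow_succ', Module.End.mul_apply, hT, hTw j (by omega), ← hpow (n + 1) le_rfl,
        hww _ le_rfl _ (by omega)]
      congr 1; omega
    -- The relation for `u (n + 2)` transfers to the shift: both sides have equal products with the
    -- spanning vectors `w j`.
    have heq : (T ^ (n + 2)) (w 0) = ∑ i, q i • w i := by
      rw [← sub_eq_zero]
      apply (Submodule.mem_bot ℝ).mp
      rw [← Submodule.top_orthogonal_eq_bot, ← hspan, Submodule.mem_orthogonal']
      intro x hx
      induction hx using Submodule.span_induction with
      | mem x hx =>
        obtain ⟨j, hj, rfl⟩ := hx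
        rw [inner_sub_left, hTj j hj,
          inner_sum_smul_self (fun i hi j hj => hww i (by omega) j (by omega)) q hj, hq1 j hj,
          sub_self]
      | zero => exact inner_zero_right _
      | add x y _ _ hx hy => rw [inner_add_right, hx, hy, add_zero]
      | smul a x _ hx => rw [real_inner_smul_right, hx, mul_zero]
    have : γ (2 * n + 4) = inner ℝ ((T ^ (n + 2)) (w 0)) ((T ^ (n + 2)) (w 0)) := by
      rw [← hq2]
      nth_rw 1 [heq]
      refine Eq.trans ?_ (inner_sum_smul q (fun i : Fin (n + 1) => w i) _).symm
      refine Finset.sum_congr rfl fun i _ => ?_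
      rw [real_inner_comm, hTj i (Nat.lt_succ_iff.mp i.2)]
    rw [this, hcl]
    exact Finset.sum_congr rfl fun i _ => by congr 2; omega

end Hankel

/-! ### Reduction of the bisequence to one variable -/

section Moments

/-- Reduction modulo `y = x³`: such a bisequence is determined by `blockSeq β`. -/
theorem eq_blockSeq_of_shift {k : ℕ} {β : ℕ → ℕ → ℝ}
    (h : ∀ i j, i + j + 3 ≤ 2 * k → β i (j + 1) = β (i + 3) j) (i j : ℕ) (hij : i + j ≤ 2 * k) :
    β i j = blockSeq β (i + 3 * j) := by
  induction i using Nat.strong_induction_on generalizing j with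
  | _ i ih =>
    rcases Nat.lt_or_ge i 3 with hi | hi
    · rw [blockSeq]
      congr 1 <;> omega
    · obtain ⟨i, rfl⟩ := Nat.exists_eq_add_of_le' hi
      rw [← h i j (by omega), ih i (by omega) (j + 1) (by omega)]
      congr 1; omega

theorem evalColumns_apply (k : ℕ) (β : ℕ → ℕ → ℝ) (p : MvPolynomial (Fin 2) ℝ)
    (b : exponents k) :
    evalColumns k β p b =
      ∑ a : exponents k, coeffVec k p a * β (b.1.1 + a.1.1) (b.1.2 + a.1.2) := by
  simp [evalColumns, momentMatrix, Matrix.col]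

theorem evalColumns_sub (k : ℕ) (β : ℕ → ℕ → ℝ) (p q : MvPolynomial (Fin 2) ℝ) :
    evalColumns k β (p - q) = evalColumns k β p - evalColumns k β q := by
  ext b
  simp only [Pi.sub_apply, evalColumns_apply, ← Finset.sum_sub_distrib, ← sub_mul]
  simp [coeffVec]

theorem mem_exponents {k i j : ℕ} : (i, j) ∈ exponents k ↔ i + j ≤ k := by
  simp only [exponents, Finset.mem_filter, Finset.mem_product, Finset.mem_range]
  omega

theorem evalColumns_X_pow_mul_X_pow {k i j : ℕ} (hij : i + j ≤ k) (β : ℕ → ℕ → ℝ)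
    (b : exponents k) :
    evalColumns k β (MvPolynomial.X 0 ^ i * MvPolynomial.X 1 ^ j) b =
      β (b.1.1 + i) (b.1.2 + j) := by
  classical
  rw [evalColumns_apply, Finset.sum_eq_single ⟨(i, j), mem_exponents.mpr hij⟩]
  · simp [coeffVec, MvPolynomial.X_pow_eq_monomial, MvPolynomial.monomial_mul,
      MvPolynomial.coeff_monomial]
  · rintro ⟨⟨a₁, a₂⟩, ha⟩ _ hne
    have : ¬ (Finsupp.single 0 i + Finsupp.single 1 j : Fin 2 →₀ ℕ) =
        Finsupp.single 0 a₁ + Finsupp.single 1 a₂ := by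
      intro h
      apply hne
      have h0 := DFunLike.congr_fun h 0
      have h1 := DFunLike.congr_fun h 1
      simp at h0 h1
      simp [h0, h1]
    simp [coeffVec, MvPolynomial.X_pow_eq_monomial, MvPolynomial.monomial_mul,
      MvPolynomial.coeff_monomial, this]
  · simp

theorem totalDegree_X_pow_mul_X_pow_le (i j : ℕ) :
    (MvPolynomial.X 0 ^ i * MvPolynomial.X 1 ^ j : MvPolynomial (Fin 2) ℝ).totalDegree ≤ i + j :=
  (MvPolynomial.totalDegree_mul _ _).trans
    (add_le_add (MvPolynomial.totalDegree_X_pow _ _).le (MvPolynomial.totalDegree_X_pow _ _).le)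

/-- The relation `Y = X³`, propagated by recursive generation. -/
theorem columnRelation_iff_shift {k : ℕ} {β : ℕ → ℕ → ℝ} (hk : 1 ≤ k)
    (hrg : RecursivelyGenerated k β) :
    ((3 ≤ k → evalColumns k β (MvPolynomial.X 1 - MvPolynomial.X 0 ^ 3) = 0) ∧
        (k = 2 → β 0 1 = β 3 0 ∧ β 1 1 = β 4 0 ∧ β 0 2 = β 3 1)) ↔
      ∀ i j, i + j + 3 ≤ 2 * k → β i (j + 1) = β (i + 3) j := by
  constructor
  · rintro ⟨h3, h2⟩ i j hij
    rcases Nat.lt_or_ge k 3 with hk3 | hk3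
    · obtain rfl : k = 2 := by omega
      obtain ⟨h01, h11, h02⟩ := h2 rfl
      obtain ⟨rfl, rfl⟩ | ⟨rfl, rfl⟩ | ⟨rfl, rfl⟩ :
          (i = 0 ∧ j = 0) ∨ (i = 1 ∧ j = 0) ∨ (i = 0 ∧ j = 1) := by omega
      · exact h01
      · exact h11
      · exact h02
    · have hd1 (a b : ℕ) (hab : a + b + 3 ≤ k) :
          ((MvPolynomial.X 0 ^ a * MvPolynomial.X 1 ^ (b + 1) -
            MvPolynomial.X 0 ^ (a + 3) * MvPolynomial.X 1 ^ b :
              MvPolynomial (Fin 2) ℝ)).totalDegree ≤ k := by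
        refine (MvPolynomial.totalDegree_sub _ _).trans (max_le ?_ ?_)
        · exact (totalDegree_X_pow_mul_X_pow_le _ _).trans (by omega)
        · exact (totalDegree_X_pow_mul_X_pow_le _ _).trans (by omega)
      have hmul (a b : ℕ) : ((MvPolynomial.X 1 - MvPolynomial.X 0 ^ 3) *
          (MvPolynomial.X 0 ^ a * MvPolynomial.X 1 ^ b) : MvPolynomial (Fin 2) ℝ) =
          MvPolynomial.X 0 ^ a * MvPolynomial.X 1 ^ (b + 1) -
            MvPolynomial.X 0 ^ (a + 3) * MvPolynomial.X 1 ^ b := by ring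
      have key (a b : ℕ) (hab : a + b + 3 ≤ k) (c d : ℕ) (hcd : c + d ≤ k) :
          β (c + a) (d + (b + 1)) = β (c + (a + 3)) (d + b) := by
        have h := hrg (MvPolynomial.X 1 - MvPolynomial.X 0 ^ 3)
          (MvPolynomial.X 0 ^ a * MvPolynomial.X 1 ^ b)
          (by simpa using hd1 0 0 (by omega))
          ((totalDegree_X_pow_mul_X_pow_le _ _).trans (by omega))
          (by rw [hmul]; exact hd1 a b hab) (h3 hk3)
        rw [hmul, evalColumns_sub, sub_eq_zero] at h
        have h := congrFun h ⟨(c, d), mem_exponents.mpr hcd⟩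
        rwa [evalColumns_X_pow_mul_X_pow (by omega), evalColumns_X_pow_mul_X_pow (by omega)] at h
      -- Split `x^i y^j` into a multiplier of degree at most `k - 3` and a row label of degree at
      -- most `k`, filling the multiplier first.
      obtain ⟨a, c, b, d, hac, hbd, hab, hcd⟩ : ∃ a c b d, i = c + a ∧ j = d + b ∧
          a + b + 3 ≤ k ∧ c + d ≤ k := by
        rcases Nat.le_total i (k - 3) with hi | hi
        · rcases Nat.le_total j (k - 3 - i) with hj | hj
          · exact ⟨i, 0, j, 0, by omega, by omega, by omega, by omega⟩
          · exact ⟨i, 0, k - 3 - i, j - (k - 3 - i), by omega, by omega, by omega, by omega⟩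
        · exact ⟨k - 3, i - (k - 3), 0, j, by omega, by omega, by omega, by omega⟩
      subst hac hbd
      have := key a b hab c d hcd
      rwa [← add_assoc, ← add_assoc] at this
  · intro h
    refine ⟨fun hk3 => ?_, fun hk2 => ?_⟩
    · ext ⟨⟨c, d⟩, hb⟩
      have hcd := mem_exponents.mp hb
      have e1 := evalColumns_X_pow_mul_X_pow (k := k) (i := 0) (j := 1) (by omega) β ⟨(c, d), hb⟩
      have e2 := evalColumns_X_pow_mul_X_pow (k := k) (i := 3) (j := 0) (by omega) β ⟨(c, d), hb⟩
      simp only [pow_zero, one_mul, mul_one, pow_one, add_zero] at e1 e2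
      rw [evalColumns_sub, Pi.sub_apply, e1, e2, h c d (by omega), sub_self, Pi.zero_apply]
    · subst hk2
      exact ⟨h 0 0 (by norm_num), h 1 0 (by norm_num), h 0 1 (by norm_num)⟩

/-- On `y = x³`, the moment matrix is the Gram matrix of vectors `u m`, `m ≤ 3k - 2` or
`m = 3k`. -/
theorem exists_inner_eq_of_momentMatrix {k n : ℕ} (hn : 3 * k = n + 2) {β : ℕ → ℕ → ℝ}
    (hpsd : (momentMatrix k β).PosSemidef)
    (h : ∀ i j, i + j + 3 ≤ 2 * k → β i (j + 1) = β (i + 3) j) :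
    ∃ u : ℕ → EuclideanSpace ℝ (exponents k),
      (∀ i ≤ n, ∀ j ≤ n, inner ℝ (u i) (u j) = blockSeq β (i + j)) ∧
      (∀ i ≤ n, inner ℝ (u i) (u (n + 2)) = blockSeq β (n + 2 + i)) ∧
      inner ℝ (u (n + 2)) (u (n + 2)) = blockSeq β (2 * n + 4) ∧
      ((hankel n (blockSeq β)).rank = (momentMatrix k β).rank →
        u (n + 2) ∈ Submodule.span ℝ (u '' Set.Iic n)) := by
  obtain ⟨v, hv⟩ := exists_inner_eq_of_posSemidef hpsd
  -- `m = n + 1 = 3k - 1` is left out: its label `(2, k - 1)` has degree `k + 1`.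
  have hmem (m : ℕ) (hm : m ≤ n ∨ m = n + 2) : (m % 3, m / 3) ∈ exponents k := by
    rw [mem_exponents]; omega
  let u : ℕ → EuclideanSpace ℝ (exponents k) := fun m =>
    if hm : m ≤ n ∨ m = n + 2 then v ⟨_, hmem m hm⟩ else 0
  have hu (m : ℕ) (hm : m ≤ n ∨ m = n + 2) : u m = v ⟨_, hmem m hm⟩ := dif_pos hm
  have huu (i) (hi : i ≤ n ∨ i = n + 2) (j) (hj : j ≤ n ∨ j = n + 2) :
      inner ℝ (u i) (u j) = blockSeq β (i + j) := by
    rw [hu i hi, hu j hj, hv]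
    change β (i % 3 + j % 3) (i / 3 + j / 3) = _
    have h1 := mem_exponents.mp (hmem i hi)
    have h2 := mem_exponents.mp (hmem j hj)
    rw [eq_blockSeq_of_shift h _ _ (by omega)]
    congr 1; omega
  have hun : ∀ i ≤ n, ∀ j ≤ n, inner ℝ (u i) (u j) = blockSeq β (i + j) :=
    fun i hi j hj => huu i (.inl hi) j (.inl hj)
  refine ⟨u, hun, fun i hi => ?_, ?_, fun hr => ?_⟩
  · rw [huu i (.inl hi) _ (.inr rfl), add_comm]
  · rw [huu _ (.inr rfl) _ (.inr rfl)]
    congr 1; omega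
  · have hle : Submodule.span ℝ (u '' Set.Iic n) ≤ Submodule.span ℝ (Set.range v) := by
      apply Submodule.span_mono
      rintro _ ⟨i, hi, rfl⟩
      rw [hu i (.inl hi)]
      exact ⟨_, rfl⟩
    rw [Submodule.eq_of_le_of_finrank_eq hle (by
      rw [finrank_span_image_Iic hun, hr, rank_eq_finrank_span_of_inner_eq hv]),
      hu _ (.inr rfl)]
    exact Submodule.subset_span ⟨_, rfl⟩

end Moments

/-! ### Ranks and determinants of atomic moment matrices -/

section Rank

/-- The rank of the moment matrix of a finitely atomic measure is the number of atoms, provided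
sufficiently many powers occur. -/
theorem rank_eq_card_of_eq_sum {ι : Type*} [Fintype ι] {G : Matrix ι ι ℝ} {s : Finset ℝ}
    {w : ℝ → ℝ} (hw : ∀ t ∈ s, 0 < w t) {e : ι → ℕ} (he : ∀ m < s.card, ∃ a, e a = m)
    (hG : ∀ a b, G a b = ∑ t ∈ s, w t * t ^ (e a + e b)) : G.rank = s.card := by
  -- A weighted Vandermonde factor: its rows are independent, as the exponents `0, …, s.card - 1`
  -- separate the points.
  let B : Matrix s ι ℝ := Matrix.of fun t a => Real.sqrt (w t) * (t : ℝ) ^ e a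
  have hGB : G = B.transpose * B := by
    ext a b
    rw [hG, Matrix.mul_apply, ← Finset.sum_coe_sort]
    refine Finset.sum_congr rfl fun t _ => ?_
    have := Real.mul_self_sqrt (hw t t.2).le
    simp only [Matrix.transpose_apply, B, Matrix.of_apply]
    rw [pow_add]
    linear_combination -(t : ℝ) ^ e a * (t : ℝ) ^ e b * this
  rw [hGB, Matrix.rank_transpose_mul_self, LinearIndependent.rank_matrix, Fintype.card_coe]
  rw [Fintype.linearIndependent_iff]
  intro g hg
  let f := s.equivFin.symm
  have hz : (fun i => g (f i) * Real.sqrt (w (f i))) = 0 := by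
    apply Matrix.eq_zero_of_forall_pow_sum_mul_pow_eq_zero (f := fun i => (f i : ℝ))
      (Subtype.val_injective.comp f.injective)
    intro i
    obtain ⟨a, ha⟩ := he i i.2
    have := congrFun hg a
    simp only [Finset.sum_apply, Pi.smul_apply, Pi.zero_apply, smul_eq_mul, Matrix.row, B,
      Matrix.of_apply, ha] at this
    rw [← this, ← f.sum_comp]
    exact Finset.sum_congr rfl fun j _ => by ring
  intro t
  have := congrFun hz (f.symm t)
  simp only [Equiv.apply_symm_apply, Pi.zero_apply] at this
  exact (mul_eq_zero.mp this).resolve_right (Real.sqrt_pos.mpr (hw t t.2)).ne'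

/-- A nonsingular Hankel matrix of size `n` whose moments come from `n` weighted points forces
these points to be distinct and to carry positive mass. -/
theorem injective_of_hankel_det_ne_zero {n : ℕ} {γ : ℕ → ℝ} (h : (hankel n γ).det ≠ 0)
    {c l : Fin (n + 1) → ℝ} (hcl : ∀ m ≤ 2 * n, γ m = ∑ i, c i ^ 2 * l i ^ m) :
    Function.Injective l ∧ ∀ i, c i ≠ 0 := by
  let B : Matrix (Fin (n + 1)) (Fin (n + 1)) ℝ := Matrix.diagonal c * Matrix.vandermonde l
  have hB : hankel n γ = B.transpose * B := by
    ext a b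
    rw [hankel, Matrix.of_apply, hcl _ (by omega), Matrix.mul_apply]
    refine Finset.sum_congr rfl fun t _ => ?_
    simp only [Matrix.transpose_apply, B, Matrix.diagonal_mul, Matrix.vandermonde_apply]
    ring
  rw [hB, Matrix.det_mul, Matrix.det_transpose, Matrix.det_mul, Matrix.det_diagonal] at h
  have h1 := left_ne_zero_of_mul h
  exact ⟨Matrix.det_vandermonde_ne_zero_iff.mp (right_ne_zero_of_mul h1),
    fun i => Finset.prod_ne_zero_iff.mp (left_ne_zero_of_mul h1) i (Finset.mem_univ i)⟩

end Rank

/-! ### Measures on the cubic -/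

section Measure

/-- The measure with masses `w i` at the points `(l i, l i ^ 3)`, `i ∈ s`, of the cubic. -/
noncomputable def cubicAtoms {ι : Type*} (s : Finset ι) (w l : ι → ℝ) : Measure (ℝ × ℝ) :=
  ∑ i ∈ s, ENNReal.ofReal (w i) • Measure.dirac (l i, l i ^ 3)

theorem isClosed_cubic : IsClosed cubic :=
  isClosed_eq continuous_snd (continuous_fst.pow 3)

theorem ae_cubicAtoms_mem_cubic {ι : Type*} (s : Finset ι) (w l : ι → ℝ) :
    cubic ∈ ae (cubicAtoms s w l) := by
  rw [mem_ae_iff, cubicAtoms, Measure.finsetSum_apply]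
  refine Finset.sum_eq_zero fun i _ => ?_
  rw [Measure.smul_apply, Measure.dirac_apply' _ isClosed_cubic.measurableSet.compl]
  simp [cubic]

theorem integrable_cubicAtoms {ι : Type*} (s : Finset ι) (w l : ι → ℝ) (f : ℝ × ℝ → ℝ) :
    Integrable f (cubicAtoms s w l) :=
  integrable_finsetSum_measure.mpr fun _ _ =>
    (integrable_dirac (by simp)).smul_measure ENNReal.ofReal_ne_top

theorem integral_cubicAtoms {ι : Type*} {s : Finset ι} {w : ι → ℝ} (hw : ∀ i ∈ s, 0 ≤ w i)
    (l : ι → ℝ) (f : ℝ × ℝ → ℝ) :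
    ∫ z, f z ∂cubicAtoms s w l = ∑ i ∈ s, w i * f (l i, l i ^ 3) := by
  rw [cubicAtoms, integral_finsetSum_measure fun _ _ =>
    (integrable_dirac (by simp)).smul_measure ENNReal.ofReal_ne_top]
  refine Finset.sum_congr rfl fun i hi => ?_
  rw [integral_smul_measure, integral_dirac, ENNReal.toReal_ofReal (hw i hi), smul_eq_mul]

theorem isAtomic_cubicAtoms {ι : Type*} {s : Finset ι} {w : ι → ℝ} (hw : ∀ i ∈ s, 0 < w i)
    {l : ι → ℝ} (hl : Function.Injective l) : IsAtomic s.card (cubicAtoms s w l) := by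
  let f : ι ↪ ℝ × ℝ := ⟨fun i => (l i, l i ^ 3), fun i j h => hl (congrArg Prod.fst h)⟩
  have hext (i) : Function.extend f w 0 (f i) = w i := f.injective.extend_apply _ _ _
  refine ⟨s.map f, Function.extend f w 0, Finset.card_map f, ?_, ?_⟩
  · intro z hz
    obtain ⟨i, hi, rfl⟩ := Finset.mem_map.mp hz
    rw [hext]
    exact hw i hi
  · rw [Finset.sum_map]
    simp only [hext]
    rfl

/-- Point masses on the cubic with the right moments in `x` represent `β`. -/
theorem isRepresenting_cubicAtoms {k : ℕ} {β : ℕ → ℕ → ℝ}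
    (h : ∀ i j, i + j + 3 ≤ 2 * k → β i (j + 1) = β (i + 3) j) {ι : Type*} {s : Finset ι}
    {w : ι → ℝ} (hw : ∀ i ∈ s, 0 ≤ w i) {l : ι → ℝ}
    (hm : ∀ m, m + 2 ≤ 6 * k ∨ m = 6 * k → blockSeq β m = ∑ i ∈ s, w i * l i ^ m) :
    IsRepresenting k β cubic (cubicAtoms s w l) := by
  refine ⟨Measure.support_subset_of_isClosed isClosed_cubic (ae_cubicAtoms_mem_cubic s w l),
    fun i j hij => ⟨integrable_cubicAtoms _ _ _ _, ?_⟩⟩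
  -- `i + j ≤ 2k` excludes `i + 3j = 6k - 1`.
  rw [integral_cubicAtoms hw, eq_blockSeq_of_shift h i j hij, hm _ (by omega)]
  exact Finset.sum_congr rfl fun t _ => by ring

variable {k : ℕ} {β : ℕ → ℕ → ℝ} {μ : Measure (ℝ × ℝ)}

theorem IsRepresenting.ae_mem_cubic (hμ : IsRepresenting k β cubic μ) :
    ∀ᵐ z ∂μ, z.2 = z.1 ^ 3 := by
  filter_upwards [Measure.support_mem_ae (μ := μ)] with z hz using hμ.1 hz

theorem IsRepresenting.moment (hμ : IsRepresenting k β cubic μ) {i j : ℕ} (hij : i + j ≤ 2 * k) :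
    Integrable (fun z : ℝ × ℝ => z.1 ^ (i + 3 * j)) μ ∧ β i j = ∫ z, z.1 ^ (i + 3 * j) ∂μ := by
  have hae : (fun z : ℝ × ℝ => z.1 ^ i * z.2 ^ j) =ᵐ[μ] fun z => z.1 ^ (i + 3 * j) := by
    filter_upwards [hμ.ae_mem_cubic] with z hz
    rw [hz, pow_add, pow_mul]
  obtain ⟨h1, h2⟩ := hμ.2 i j hij
  exact ⟨h1.congr hae, h2.trans (integral_congr_ae hae)⟩

theorem IsRepresenting.shift (hμ : IsRepresenting k β cubic μ) (i j : ℕ)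
    (hij : i + j + 3 ≤ 2 * k) : β i (j + 1) = β (i + 3) j := by
  rw [(hμ.moment (i := i) (j := j + 1) (by omega)).2,
    (hμ.moment (i := i + 3) (j := j) (by omega)).2,
    show i + 3 * (j + 1) = i + 3 + 3 * j by ring]

/-- The bound is sharp for this argument: at `m = 6k - 1` the label `(2, 2k - 1)` has degree `2k +
1`. -/
theorem IsRepresenting.blockSeq_moment (hμ : IsRepresenting k β cubic μ) {m : ℕ}
    (hm : m + 2 ≤ 6 * k) :
    Integrable (fun z : ℝ × ℝ => z.1 ^ m) μ ∧ blockSeq β m = ∫ z, z.1 ^ m ∂μ := by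
  have := hμ.moment (i := m % 3) (j := m / 3) (by omega)
  rwa [Nat.mod_add_div] at this

theorem IsRepresenting.isFiniteMeasure (hμ : IsRepresenting k β cubic μ) : IsFiniteMeasure μ := by
  have := (hμ.2 0 0 (Nat.zero_le _)).1
  simpa [integrable_const_iff] using this

/-- The quadratic form of the Hankel matrix is the integral of the square of a polynomial. -/
theorem IsRepresenting.hankel_quadraticForm (hμ : IsRepresenting k β cubic μ) {n : ℕ}
    (hn : 2 * n + 2 ≤ 6 * k) (a : Fin (n + 1) → ℝ) :
    Integrable (fun z : ℝ × ℝ => (∑ i, a i * z.1 ^ (i : ℕ)) ^ 2) μ ∧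
      dotProduct a ((hankel n (blockSeq β)).mulVec a) =
        ∫ z, (∑ i, a i * z.1 ^ (i : ℕ)) ^ 2 ∂μ := by
  have hsq : (fun z : ℝ × ℝ => (∑ i, a i * z.1 ^ (i : ℕ)) ^ 2) =
      fun z => ∑ i, ∑ j, a i * a j * z.1 ^ ((i : ℕ) + j) := by
    ext z
    rw [sq, Finset.sum_mul_sum]
    exact Finset.sum_congr rfl fun i _ => Finset.sum_congr rfl fun j _ => by ring
  have hint (i j : Fin (n + 1)) :
      Integrable (fun z : ℝ × ℝ => a i * a j * z.1 ^ ((i : ℕ) + j)) μ :=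
    (hμ.blockSeq_moment (by omega)).1.const_mul _
  rw [hsq]
  refine ⟨integrable_finsetSum _ fun i _ => integrable_finsetSum _ fun j _ => hint i j, ?_⟩
  rw [integral_finsetSum _ fun i _ => integrable_finsetSum _ fun j _ => hint i j]
  refine Finset.sum_congr rfl fun i _ => ?_
  rw [integral_finsetSum _ fun j _ => hint i j, Matrix.mulVec, dotProduct, Finset.mul_sum]
  refine Finset.sum_congr rfl fun j _ => ?_
  rw [integral_const_mul, ← (hμ.blockSeq_moment (m := i + j) (by omega)).2, hankel,
    Matrix.of_apply]
  ring

theorem hankel_isHermitian (n : ℕ) (γ : ℕ → ℝ) : (hankel n γ).IsHermitian := by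
  ext i j
  simp [hankel, add_comm]

theorem IsRepresenting.hankel_posSemidef (hμ : IsRepresenting k β cubic μ) {n : ℕ}
    (hn : 2 * n + 2 ≤ 6 * k) : (hankel n (blockSeq β)).PosSemidef := by
  refine .of_dotProduct_mulVec_nonneg (hankel_isHermitian _ _) fun a => ?_
  rw [star_trivial, (hμ.hankel_quadraticForm hn a).2]
  exact integral_nonneg fun z => sq_nonneg _

/-- A finite measure concentrated on finitely many points of the cubic is a combination of point
masses. -/
theorem eq_cubicAtoms_of_ae [IsFiniteMeasure μ] {s : Finset ℝ}
    (hs : ∀ᵐ z ∂μ, z.2 = z.1 ^ 3 ∧ z.1 ∈ s) :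
    ∃ (t : Finset ℝ) (w : ℝ → ℝ), t ⊆ s ∧ (∀ x ∈ t, 0 < w x) ∧ μ = cubicAtoms t w id := by
  classical
  let w : ℝ → ℝ := fun x => μ.real {(x, x ^ 3)}
  -- Candidate points without mass are discarded, since atoms need positive weight.
  refine ⟨s.filter fun x => w x ≠ 0, w, Finset.filter_subset _ _, fun x hx => ?_, ?_⟩
  · exact lt_of_le_of_ne measureReal_nonneg (Finset.mem_filter.mp hx).2.symm
  · ext A hA
    let f : ℝ ↪ ℝ × ℝ := ⟨fun x => (x, x ^ 3), fun x y h => congrArg Prod.fst h⟩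
    have h1 : μ A = μ ((s.map f).filter (· ∈ A) : Finset (ℝ × ℝ)) := by
      apply measure_congr
      filter_upwards [hs] with z hz
      apply propext
      have : z ∈ s.map f := Finset.mem_map.mpr ⟨z.1, hz.2, Prod.ext rfl hz.1.symm⟩
      change z ∈ A ↔ z ∈ ((s.map f).filter (· ∈ A) : Finset (ℝ × ℝ))
      simp only [Finset.mem_filter, this, true_and]
    rw [h1, ← sum_measure_singleton, Finset.sum_filter, Finset.sum_map, cubicAtoms,
      Measure.finsetSum_apply, Finset.sum_filter]
    refine Finset.sum_congr rfl fun x _ => ?_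
    have hwx : ENNReal.ofReal (w x) = μ {(x, x ^ 3)} := ENNReal.ofReal_toReal (by finiteness)
    rw [Measure.smul_apply, Measure.dirac_apply' _ hA, id, hwx]
    change (if (x, x ^ 3) ∈ A then μ {(x, x ^ 3)} else 0) = _
    by_cases hx : (x, x ^ 3) ∈ A
    · by_cases hw0 : w x = 0
      · rw [hw0, ENNReal.ofReal_zero] at hwx
        simp [hw0, ← hwx]
      · simp [hx, hw0]
    · simp [hx]

/-- A kernel vector of the Hankel matrix is a polynomial whose square has integral zero, so `μ`
lives over its at most `n` roots. -/
theorem IsRepresenting.exists_eq_cubicAtoms (hμ : IsRepresenting k β cubic μ) {n : ℕ}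
    (hn : 2 * n + 2 ≤ 6 * k) (hdet : (hankel n (blockSeq β)).det = 0) :
    ∃ (t : Finset ℝ) (w : ℝ → ℝ), t.card ≤ n ∧ (∀ x ∈ t, 0 < w x) ∧ μ = cubicAtoms t w id := by
  classical
  obtain ⟨a, ha, ha0⟩ := Matrix.exists_mulVec_eq_zero_iff.mpr hdet
  obtain ⟨hint, hform⟩ := hμ.hankel_quadraticForm hn a
  rw [ha0, dotProduct_zero] at hform
  have hae := (integral_eq_zero_iff_of_nonneg (fun z => sq_nonneg _) hint).mp hform.symm
  let p : Polynomial ℝ := ∑ i : Fin (n + 1), Polynomial.monomial i (a i)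
  have hcoeff (j : Fin (n + 1)) : p.coeff j = a j := by
    simp [p, Polynomial.finsetSum_coeff, Polynomial.coeff_monomial, Fin.val_inj]
  have hp0 : p ≠ 0 := by
    rintro hp
    exact ha (funext fun j => by rw [← hcoeff, hp, Polynomial.coeff_zero, Pi.zero_apply])
  have hdeg : p.natDegree ≤ n := Polynomial.natDegree_sum_le_of_forall_le _ _ fun i _ =>
    (Polynomial.natDegree_monomial_le _).trans (Nat.lt_succ_iff.mp i.2)
  have := hμ.isFiniteMeasure
  obtain ⟨t, w, hts, hw, ht⟩ := eq_cubicAtoms_of_ae (μ := μ) (s := p.roots.toFinset) (by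
    filter_upwards [hae, hμ.ae_mem_cubic] with z hz hz3
    refine ⟨hz3, ?_⟩
    rw [Multiset.mem_toFinset, Polynomial.mem_roots hp0, Polynomial.IsRoot]
    simpa [p, Polynomial.eval_finsetSum] using hz)
  exact ⟨t, w, ((Finset.card_le_card hts).trans (Multiset.toFinset_card_le _)).trans
    ((Polynomial.card_roots' p).trans hdeg), hw, ht⟩

theorem IsRepresenting.hankel_rank_eq {t : Finset ℝ} {w : ℝ → ℝ} (hw : ∀ x ∈ t, 0 < w x)
    (hμ : IsRepresenting k β cubic (cubicAtoms t w id)) {n : ℕ} (hn : 2 * n + 2 ≤ 6 * k)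
    (ht : t.card ≤ n + 1) : (hankel n (blockSeq β)).rank = t.card := by
  refine rank_eq_card_of_eq_sum hw (e := fun i : Fin (n + 1) => i)
    (fun m hm => ⟨⟨m, by omega⟩, rfl⟩) fun a b => ?_
  rw [hankel, Matrix.of_apply, (hμ.blockSeq_moment (by omega)).2,
    integral_cubicAtoms fun x hx => (hw x hx).le]
  rfl

/-- The powers `x^m` with `m ≤ 3k - 2` all come from monomials of degree at most `k`, enough to
separate `3k - 1` atoms. -/
theorem IsRepresenting.momentMatrix_rank_eq {t : Finset ℝ} {w : ℝ → ℝ} (hw : ∀ x ∈ t, 0 < w x)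
    (hμ : IsRepresenting k β cubic (cubicAtoms t w id)) (ht : t.card + 1 ≤ 3 * k) :
    (momentMatrix k β).rank = t.card := by
  refine rank_eq_card_of_eq_sum hw (e := fun a : exponents k => a.1.1 + 3 * a.1.2)
    (fun m hm => ⟨⟨(m % 3, m / 3), mem_exponents.mpr (by omega)⟩, Nat.mod_add_div m 3⟩)
    fun a b => ?_
  have ha : a.1.1 + a.1.2 ≤ k := mem_exponents.mp a.2
  have hb : b.1.1 + b.1.2 ≤ k := mem_exponents.mp b.2
  rw [momentMatrix, Matrix.of_apply,
    (hμ.moment (i := a.1.1 + b.1.1) (j := a.1.2 + b.1.2) (by omega)).2,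
    integral_cubicAtoms fun x hx => (hw x hx).le]
  exact Finset.sum_congr rfl fun x _ => by simp only [id]; ring

end Measure

/-! ### Existence of representing measures and the main theorem -/

section Solution

variable {k n : ℕ} {β : ℕ → ℕ → ℝ}

theorem exists_representing_of_hankel_posDef (hn : 3 * k = n + 2)
    (hpsd : (momentMatrix k β).PosSemidef)
    (hshift : ∀ i j, i + j + 3 ≤ 2 * k → β i (j + 1) = β (i + 3) j)
    (h : (hankel (n + 1) (blockSeq β)).PosDef) :
    ∃ μ : Measure (ℝ × ℝ), IsRepresenting k β cubic μ ∧ IsAtomic (3 * k) μ := by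
  obtain ⟨u, hu, hu', hu'', -⟩ := exists_inner_eq_of_momentMatrix hn hpsd hshift
  obtain ⟨c, l, hcl⟩ := exists_atoms_of_hankel_posDef h hu hu' hu''
  -- The spectral theorem allows repeated nodes and zero weights; nonsingularity rules both out,
  -- giving exactly `3k` atoms.
  obtain ⟨hl, hc⟩ := injective_of_hankel_det_ne_zero (h.posSemidef.posDef_iff_det_ne_zero.mp h)
    (fun m hm => hcl m (.inl (by omega)))
  refine ⟨cubicAtoms Finset.univ (fun i => c i ^ 2) l, isRepresenting_cubicAtoms hshift
    (fun i _ => sq_nonneg _) fun m hm => hcl m (by omega), ?_⟩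
  rw [hn]
  have := isAtomic_cubicAtoms (s := Finset.univ) (w := fun i => c i ^ 2)
    (fun i _ => pow_two_pos_of_ne_zero (hc i)) hl
  rwa [Finset.card_univ, Fintype.card_fin] at this

theorem exists_representing_of_hankel_rank_eq (hn : 3 * k = n + 2)
    (hpsd : (momentMatrix k β).PosSemidef)
    (hshift : ∀ i j, i + j + 3 ≤ 2 * k → β i (j + 1) = β (i + 3) j)
    (h : (hankel (n + 1) (blockSeq β)).PosSemidef)
    (h1 : (hankel n (blockSeq β)).rank = (hankel (n + 1) (blockSeq β)).rank)
    (h2 : (hankel (n + 1) (blockSeq β)).rank = (momentMatrix k β).rank) :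
    ∃ μ : Measure (ℝ × ℝ), IsRepresenting k β cubic μ := by
  obtain ⟨u, hu, hu', hu'', hmem⟩ := exists_inner_eq_of_momentMatrix hn hpsd hshift
  obtain ⟨d, c, l, hcl⟩ := exists_atoms_of_hankel_rank_eq h h1 hu hu' hu'' (hmem (h1.trans h2))
  exact ⟨cubicAtoms Finset.univ (fun i => c i ^ 2) l, isRepresenting_cubicAtoms hshift
    (fun i _ => sq_nonneg _) fun m hm => hcl m (by omega)⟩

end Solution

end CubicMoment

open CubicMoment MeasureTheory in
theorem corollary3p3 (k : ℕ) (hk : 1 ≤ k) (β : ℕ → ℕ → ℝ)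
    (hpsd : (momentMatrix k β).PosSemidef) (hrg : RecursivelyGenerated k β) :
    ((∃ μ : Measure (ℝ × ℝ), IsRepresenting k β cubic μ) ↔
      ((3 ≤ k → evalColumns k β (MvPolynomial.X 1 - MvPolynomial.X 0 ^ 3) = 0) ∧
        (k = 2 → β 0 1 = β 3 0 ∧ β 1 1 = β 4 0 ∧ β 0 2 = β 3 1)) ∧
      ((hankelTilde k β).PosDef ∨
        ((hankelTilde k β).PosSemidef ∧
          (hankelHat k β).rank = (hankelTilde k β).rank ∧
          (hankelTilde k β).rank = (momentMatrix k β).rank))) ∧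
    ((∃ μ : Measure (ℝ × ℝ), IsRepresenting k β cubic μ) →
      ((hankelTilde k β).det ≠ 0 →
        ∃ μ : Measure (ℝ × ℝ), IsRepresenting k β cubic μ ∧ IsAtomic (3 * k) μ) ∧
      ((hankelTilde k β).det = 0 →
        ∀ μ : Measure (ℝ × ℝ), IsRepresenting k β cubic μ →
          IsAtomic (momentMatrix k β).rank μ)) := by
  obtain ⟨n, hn⟩ : ∃ n, 3 * k = n + 2 := ⟨3 * k - 2, by omega⟩
  rw [columnRelation_iff_shift hk hrg]
  unfold hankelTilde hankelHat
  rw [show 3 * k - 1 = n + 1 by omega, show 3 * k - 2 = n by omega]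
  refine ⟨⟨fun ⟨μ, hμ⟩ => ⟨hμ.shift, ?_⟩, ?_⟩, fun ⟨μ, hμ⟩ => ⟨fun hdet => ?_, ?_⟩⟩
  · have hpos := hμ.hankel_posSemidef (n := n + 1) (by omega)
    by_cases hdet : (hankel (n + 1) (blockSeq β)).det = 0
    · obtain ⟨t, w, ht, hw, rfl⟩ := hμ.exists_eq_cubicAtoms (by omega) hdet
      refine .inr ⟨hpos, ?_⟩
      rw [hμ.hankel_rank_eq hw (by omega) ht, hμ.hankel_rank_eq hw (by omega) (by omega),
        hμ.momentMatrix_rank_eq hw (by omega)]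
      exact ⟨rfl, rfl⟩
    · exact .inl (hpos.posDef_iff_det_ne_zero.mpr hdet)
  · rintro ⟨hshift, hpd | ⟨hps, h1, h2⟩⟩
    · obtain ⟨μ, hμ, -⟩ := exists_representing_of_hankel_posDef hn hpsd hshift hpd
      exact ⟨μ, hμ⟩
    · exact exists_representing_of_hankel_rank_eq hn hpsd hshift hps h1 h2
  · exact exists_representing_of_hankel_posDef hn hpsd hμ.shift
      ((hμ.hankel_posSemidef (by omega)).posDef_iff_det_ne_zero.mpr hdet)
  · intro hdet ν hν
    obtain ⟨t, w, ht, hw, rfl⟩ := hν.exists_eq_cubicAtoms (by omega) hdet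
    rw [hν.momentMatrix_rank_eq hw (by omega)]
    exact isAtomic_cubicAtoms hw Function.injective_id
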